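/- Let $S^1=\mathbb R/\mathbb Z$ with its usual quotient metric $d$, and let $\mathrm{Homeo}(S^1)$ be the group of all homeomorphisms of $S^1$ under composition, with the $C^0$-topology (uniform convergence). Let $\mu$ be a Borel probability measure on $\mathrm{Homeo}(S^1)$ and let $G$ be the subsemigroup of $\mathrm{Homeo}(S^1)$ generated by $\operatorname{supp}\mu$. Suppose that $G$ acts proximally on $S^1$, i.e. $\inf_{g\in G} d(gx,gy)=0$ for all $x,y\in S^1$, and that $G$ has no global fixed point, i.e. there is no $x\in S^1$ with $gx=x$ for all $g\in G$. For a Borel probability measure $\mu'$ on $\mathrm{Homeo}(S^1)$, let $g_1,g_2,\ldots$ be independent random homeomorphisms with law $\mu'$; the left, respectively right, random walk driven by $\mu'$ is $Z_n=g_n\circ\cdots\circ g_1$, respectively $Z_n=g_1\circ\cdots\circ g_n$. Then there exist $\kappa>0$ and an open neighborhood $\mathcal U$ of $\mu$ in the space of Borel probability measures on $\mathrm{Homeo}(S^1)$ with the weak-$*$ topology (convergence of integrals of bounded continuous functions) such that, for every $\mu'\in\mathcal U$ (in particular for $\mu'=\mu$), for the left as well as for the right random walk $(Z_n)_{n\ge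 1}$ driven by $\mu'$, for all $x,y\in S^1$ and all integers $n\ge 1$, $$\mathbb P\bigl(d(Z_nx,Z_ny)<e^{-\kappa n}\bigr)\ \ge\ 1-\frac1\kappa e^{-\kappa n}.$$ -/

import Mathlib

open MeasureTheory ProbabilityTheory

/-- The group of all homeomorphisms (orientation preserving or not) of the circle `ℝ / ℤ`.
The product is composition: `(f * g) x = f (g x)`. -/
abbrev CircleHomeo : Type := UnitAddCircle ≃ₜ UnitAddCircle

namespace CircleHomeo

/-- The `C⁰`-topology (uniform convergence): since the circle is compact metric, this is the
topology induced by the compact-open topology on continuous maps. -/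
instance instTopologicalSpace : TopologicalSpace CircleHomeo :=
  TopologicalSpace.induced (fun f => (⟨f, f.continuous⟩ : C(UnitAddCircle, UnitAddCircle)))
    inferInstance

/-- The Borel σ-algebra of the `C⁰`-topology. -/
instance instMeasurableSpace : MeasurableSpace CircleHomeo := borel CircleHomeo

instance instBorelSpace : BorelSpace CircleHomeo := ⟨rfl⟩

/-- A set `G` of homeomorphisms acts proximally if `inf_{g ∈ G} d(g x, g y) = 0` for all `x, y`.
The infimum is taken in `[0, ∞]`. -/
def IsProximal (G : Set CircleHomeo) : Prop :=
  ∀ x y : UnitAddCircle, ⨅ g ∈ G, edist (g x) (g y) = 0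

/-- Some point of the circle is fixed by every element of `G`. -/
def HasGlobalFixedPoint (G : Set CircleHomeo) : Prop :=
  ∃ x : UnitAddCircle, ∀ g ∈ G, g x = x

/-- The subsemigroup of the homeomorphism group generated by the support of `μ`. -/
def supportSemigroup (μ : ProbabilityMeasure CircleHomeo) : Subsemigroup CircleHomeo :=
  Subsemigroup.closure (μ : Measure CircleHomeo).support

/-- The random variables `g 0, g 1, g 2, …` on the probability space `(Ω, P)` are independent and
each has law `μ`: they are the steps of a random walk driven by `μ`. -/
structure IsIIDSteps {Ω : Type*} [MeasurableSpace Ω] (P : Measure Ω)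
    (μ : ProbabilityMeasure CircleHomeo) (g : ℕ → Ω → CircleHomeo) : Prop where
  measurable : ∀ i, Measurable (g i)
  indep : iIndepFun g P
  law : ∀ i, P.map (g i) = (μ : Measure CircleHomeo)

/-- The left random walk with steps `g 0, g 1, …`, namely `Z_n = g (n - 1) ∘ ⋯ ∘ g 0`. -/
def leftWalk {Ω : Type*} (g : ℕ → Ω → CircleHomeo) : ℕ → Ω → CircleHomeo
  | 0 => fun _ => 1
  | n + 1 => fun ω => g n ω * leftWalk g n ω

/-- The right random walk with steps `g 0, g 1, …`, namely `Z_n = g 0 ∘ ⋯ ∘ g (n - 1)`. -/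
def rightWalk {Ω : Type*} (g : ℕ → Ω → CircleHomeo) : ℕ → Ω → CircleHomeo
  | 0 => fun _ => 1
  | n + 1 => fun ω => rightWalk g n ω * g n ω

/-- For the walk `Z` on `(Ω, P)`:
`P(d(Z_n x, Z_n y) < e^{-κ n}) ≥ 1 - κ⁻¹ e^{-κ n}` for all `x, y` and all `n ≥ 1`. -/
def SynchronizesWith {Ω : Type*} [MeasurableSpace Ω] (P : Measure Ω)
    (Z : ℕ → Ω → CircleHomeo) (κ : ℝ) : Prop :=
  ∀ x y : UnitAddCircle, ∀ n : ℕ, 0 < n →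
    1 - 1 / κ * Real.exp (-κ * n) ≤
      P.real {ω | dist (Z n ω x) (Z n ω y) < Real.exp (-κ * n)}

end CircleHomeo

/-!
The left and the right walk with law `μ'` have the same distribution at each fixed time `n`, namely
the `n`-th convolution power of `μ'`, so by Markov's inequality it is enough that the mean distance
`E d(Z_n x, Z_n y) = T ^ n d (x, y)` decays exponentially, uniformly in `x`, `y` and in `μ'` near
`μ`. Here `T F (x, y) = E F (g x, g y)` is the averaging operator of `μ'` (`avg`).

The decay is measured by a squared 2-variation, called energy (`EnergyLE`): the largest value
of `∑ i, F (u i, v i) ^ 2` over families of pairs of points joined by disjoint open connected sets.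
It is invariant under all homeomorphisms, it does not increase under averaging, it bounds
`F (x, y) ^ 2`, and it is at most `1` for the metric `d` because the circle has length one. It
plays the part of the norm of `ℓ²` in the ping-pong proof of nonamenability. Suppose that
homeomorphisms `h j`, for `j < k`, map the complements of disjoint arcs `R j` into disjoint arcs
`A j`. Then the sum of the `k` translates of `F` by the `h j` has energy `O(k)` rather than
`O(k ^ 2)` (`sum_sq_sum_players_le`), because a given point lies in at most one `R j`, and pairs
outside `R j` are sent to the disjoint sets `A j`. With forty players this is a gain, so that
averaging contracts the energy by a definite factor as soon as each class of players is met with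
positive probability (`EnergyLE.avg_of_pingPong`). Being a player is an open condition, hence the
estimate persists for `μ'` near `μ` by the portmanteau theorem. Only the topological ping-pong
matters, which is why no moment or regularity of the homeomorphisms is needed.

Players exist in the semigroup (`exists_pingPong`): by proximality and compactness finite sets can
be contracted; an element that contracts a fine net maps the complement of one gap of the net into a
small arc; in the limit this gives a repelling and an attracting point. Their orbits, backward
and forward, are infinite, as a finite invariant set contradicts proximality or the absence of a
fixed point, so the two points can be moved to as many different places as desired.

The players may be words of different lengths. Their lengths are made equal by passing to the lazy
walk, which stays in place with probability one half; since it makes exactly `n` steps in time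
`2 * n` with probability at least `1 / (2 * n)`, its decay implies that of the original walk
(`iterate_avg_le_lazy`).
-/

namespace CircleHomeo

/-! ### The topology of the homeomorphism group -/

/-- The inclusion of the homeomorphisms into the continuous maps, which induces the topology. -/
def toContinuousMap (f : CircleHomeo) : C(UnitAddCircle, UnitAddCircle) := ⟨f, f.continuous⟩

lemma isInducing_toContinuousMap : Topology.IsInducing toContinuousMap := ⟨rfl⟩

instance : SecondCountableTopology CircleHomeo :=
  isInducing_toContinuousMap.secondCountableTopology

instance : TopologicalSpace.PseudoMetrizableSpace CircleHomeo :=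
  isInducing_toContinuousMap.pseudoMetrizableSpace

instance : ContinuousMul CircleHomeo where
  continuous_mul := by
    rw [isInducing_toContinuousMap.continuous_iff]
    exact ContinuousMap.continuous_comp'.comp
      ((isInducing_toContinuousMap.continuous.comp continuous_snd).prodMk
        (isInducing_toContinuousMap.continuous.comp continuous_fst))

lemma continuous_eval : Continuous fun p : CircleHomeo × UnitAddCircle => p.1 p.2 :=
  (ContinuousEval.continuous_eval (F := C(UnitAddCircle, UnitAddCircle))).comp
    (isInducing_toContinuousMap.continuous.prodMap continuous_id)

lemma isOpen_setOf_mapsTo {K V : Set UnitAddCircle} (hK : IsCompact K) (hV : IsOpen V) :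
    IsOpen {h : CircleHomeo | Set.MapsTo h K V} :=
  (ContinuousMap.isOpen_setOfPred_mapsTo hK hV).preimage isInducing_toContinuousMap.continuous

/-! ### Averaging operators -/

/-- A measurable function of two points of the circle with values in `[0, 1]`. -/
structure IsKernel (F : UnitAddCircle → UnitAddCircle → ℝ) : Prop where
  measurable : Measurable (Function.uncurry F)
  nonneg : ∀ x y, 0 ≤ F x y
  le_one : ∀ x y, F x y ≤ 1

/-- The average of the translates `F (g ·) (g ·)` of `F` over a random homeomorphism `g` with
law `ρ`. -/
noncomputable def avg (ρ : Measure CircleHomeo) (F : UnitAddCircle → UnitAddCircle → ℝ) :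
    UnitAddCircle → UnitAddCircle → ℝ :=
  fun x y => ∫ g, F (g x) (g y) ∂ρ

namespace IsKernel

variable {F : UnitAddCircle → UnitAddCircle → ℝ} {ρ σ : Measure CircleHomeo}

lemma measurable_comp (hF : IsKernel F) (x y : UnitAddCircle) :
    Measurable fun g : CircleHomeo => F (g x) (g y) := by
  have h : ∀ z : UnitAddCircle, Measurable fun g : CircleHomeo => g z := fun z =>
    (continuous_eval.comp (continuous_id.prodMk continuous_const)).measurable
  exact hF.measurable.comp ((h x).prodMk (h y))

lemma integrable_comp [IsFiniteMeasure ρ] (hF : IsKernel F) (x y : UnitAddCircle) :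
    Integrable (fun g : CircleHomeo => F (g x) (g y)) ρ := by
  refine Integrable.of_bound (hF.measurable_comp x y).aestronglyMeasurable 1 (ae_of_all _ fun g => ?_)
  rw [Real.norm_eq_abs, abs_of_nonneg (hF.nonneg _ _)]
  exact hF.le_one _ _

lemma avg [IsProbabilityMeasure ρ] (hF : IsKernel F) : IsKernel (avg ρ F) where
  measurable := by
    have h : Measurable fun q : (UnitAddCircle × UnitAddCircle) × CircleHomeo =>
        F (q.2 q.1.1) (q.2 q.1.2) := by
      refine hF.measurable.comp (Measurable.prodMk ?_ ?_)
      · exact (continuous_eval.comp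
          (continuous_snd.prodMk (continuous_fst.comp continuous_fst))).measurable
      · exact (continuous_eval.comp
          (continuous_snd.prodMk (continuous_snd.comp continuous_fst))).measurable
    exact h.stronglyMeasurable.integral_prod_right'.measurable
  nonneg x y := integral_nonneg fun g => hF.nonneg _ _
  le_one x y := by
    have := integral_mono (hF.integrable_comp (ρ := ρ) x y) (integrable_const 1)
      fun g => hF.le_one (g x) (g y)
    simpa [CircleHomeo.avg] using this

lemma iterate_avg [IsProbabilityMeasure ρ] (hF : IsKernel F) (n : ℕ) :
    IsKernel ((CircleHomeo.avg ρ)^[n] F) := by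
  induction n with
  | zero => exact hF
  | succ n ih =>
    rw [Function.iterate_succ_apply']
    exact ih.avg

lemma avg_mconv [IsProbabilityMeasure ρ] [IsProbabilityMeasure σ] (hF : IsKernel F) :
    CircleHomeo.avg (ρ ∗ₘ σ) F = CircleHomeo.avg σ (CircleHomeo.avg ρ F) := by
  funext x y
  have hi : Integrable (fun p : CircleHomeo × CircleHomeo => F ((p.1 * p.2) x) ((p.1 * p.2) y))
      (ρ.prod σ) := by
    refine Integrable.of_bound
      ((hF.measurable_comp x y).comp measurable_mul).aestronglyMeasurable 1 (ae_of_all _ fun g => ?_)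
    rw [Real.norm_eq_abs, abs_of_nonneg (hF.nonneg _ _)]
    exact hF.le_one _ _
  calc CircleHomeo.avg (ρ ∗ₘ σ) F x y
      = ∫ p, F ((p.1 * p.2) x) ((p.1 * p.2) y) ∂(ρ.prod σ) :=
        integral_map measurable_mul.aemeasurable
          (hF.measurable_comp x y).aestronglyMeasurable
    _ = ∫ h, ∫ g, F ((g * h) x) ((g * h) y) ∂ρ ∂σ := integral_prod_symm _ hi

end IsKernel

lemma isKernel_dist : IsKernel fun x y => dist x y where
  measurable := (continuous_dist (α := UnitAddCircle)).measurable
  nonneg _ _ := dist_nonneg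
  le_one x y := by
    have := AddCircle.norm_le_half_period (1 : ℝ) one_ne_zero (x := x - y)
    rw [dist_eq_norm]
    norm_num at this
    linarith

/-! ### Convolution powers -/

/-- The law of the product of `n` independent homeomorphisms with law `ρ`. -/
noncomputable def convPow (ρ : Measure CircleHomeo) : ℕ → Measure CircleHomeo
  | 0 => Measure.dirac 1
  | n + 1 => convPow ρ n ∗ₘ ρ

instance (ρ : Measure CircleHomeo) [IsProbabilityMeasure ρ] (n : ℕ) :
    IsProbabilityMeasure (convPow ρ n) := by
  induction n with
  | zero => exact Measure.dirac.isProbabilityMeasure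
  | succ n ih => exact Measure.probabilitymeasure_of_probabilitymeasures_mconv _ _

section

variable {ρ : Measure CircleHomeo} [IsProbabilityMeasure ρ]

lemma convPow_add (m n : ℕ) : convPow ρ (m + n) = convPow ρ m ∗ₘ convPow ρ n := by
  induction n with
  | zero => exact (Measure.mconv_dirac_one _).symm
  | succ n ih =>
    change convPow ρ (m + n) ∗ₘ ρ = convPow ρ m ∗ₘ (convPow ρ n ∗ₘ ρ)
    rw [ih, Measure.mconv_assoc]

lemma convPow_one : convPow ρ 1 = ρ := Measure.dirac_one_mconv ρ

lemma avg_convPow {F : UnitAddCircle → UnitAddCircle → ℝ} (hF : IsKernel F) (n : ℕ) :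
    avg (convPow ρ n) F = (avg ρ)^[n] F := by
  induction n with
  | zero =>
    funext x y
    exact integral_dirac' _ _ (hF.measurable_comp x y).stronglyMeasurable
  | succ n ih =>
    rw [Function.iterate_succ_apply', ← ih]
    exact hF.avg_mconv

/-- The law of a walk that stays in place or takes a step with law `ρ`, each with
probability one half. -/
noncomputable def lazy (ρ : Measure CircleHomeo) : Measure CircleHomeo :=
  (2⁻¹ : ENNReal) • Measure.dirac 1 + (2⁻¹ : ENNReal) • ρ

instance : IsProbabilityMeasure (lazy ρ) :=
  ⟨by simp [lazy, ENNReal.inv_two_add_inv_two]⟩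

lemma avg_lazy {F : UnitAddCircle → UnitAddCircle → ℝ} (hF : IsKernel F)
    (x y : UnitAddCircle) : avg (lazy ρ) F x y = (F x y + avg ρ F x y) / 2 := by
  have h1 : Integrable (fun g : CircleHomeo => F (g x) (g y))
      ((2⁻¹ : ENNReal) • Measure.dirac (1 : CircleHomeo)) :=
    (hF.integrable_comp x y).smul_measure (by simp)
  have h2 : Integrable (fun g : CircleHomeo => F (g x) (g y)) ((2⁻¹ : ENNReal) • ρ) :=
    (hF.integrable_comp x y).smul_measure (by simp)
  have h3 : ∫ g, F (g x) (g y) ∂(Measure.dirac (1 : CircleHomeo)) = F x y :=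
    integral_dirac' _ _ (hF.measurable_comp x y).stronglyMeasurable
  simp only [avg, lazy]
  rw [integral_add_measure h1 h2, integral_smul_measure, integral_smul_measure, h3]
  simp
  ring

/-- The lazy walk makes exactly `i` proper steps among the first `n` with probability
`n.choose i / 2 ^ n`. -/
lemma choose_mul_iterate_avg_le {F : UnitAddCircle → UnitAddCircle → ℝ} (hF : IsKernel F)
    (n i : ℕ) (x y : UnitAddCircle) :
    (n.choose i : ℝ) / 2 ^ n * (avg ρ)^[i] F x y ≤ (avg (lazy ρ))^[n] F x y := by
  induction n generalizing i x y with
  | zero =>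
    cases i with
    | zero => simp
    | succ i => simpa using hF.nonneg x y
  | succ n ih =>
    rw [Function.iterate_succ_apply', avg_lazy (hF.iterate_avg n)]
    cases i with
    | zero =>
      have h1 := ih 0 x y
      have h2 := (hF.iterate_avg (ρ := lazy ρ) n).avg (ρ := ρ) |>.nonneg x y
      simp only [Nat.choose_zero_right, pow_succ] at h1 ⊢
      have h3 : ((1 : ℕ) : ℝ) / (2 ^ n * 2) * (avg ρ)^[0] F x y =
          ((1 : ℕ) : ℝ) / 2 ^ n * (avg ρ)^[0] F x y / 2 := by field_simp
      linarith
    | succ i =>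
      have h1 := ih (i + 1) x y
      have h2 : (n.choose i : ℝ) / 2 ^ n * (avg ρ)^[i + 1] F x y ≤
          avg ρ ((avg (lazy ρ))^[n] F) x y := by
        rw [Function.iterate_succ_apply', avg, ← integral_const_mul]
        exact integral_mono (((hF.iterate_avg i).integrable_comp x y).const_mul _)
          ((hF.iterate_avg n).integrable_comp x y) fun g => ih i (g x) (g y)
      have h3 : ((n + 1).choose (i + 1) : ℝ) / 2 ^ (n + 1) * (avg ρ)^[i + 1] F x y =
          ((n.choose i : ℝ) / 2 ^ n * (avg ρ)^[i + 1] F x y +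
            (n.choose (i + 1) : ℝ) / 2 ^ n * (avg ρ)^[i + 1] F x y) / 2 := by
        rw [Nat.choose_succ_succ, pow_succ]
        push_cast
        field_simp
      linarith

/-- The central binomial coefficient bounds the original walk by the lazy one. -/
lemma iterate_avg_le_lazy {F : UnitAddCircle → UnitAddCircle → ℝ} (hF : IsKernel F)
    {n : ℕ} (hn : 0 < n) (x y : UnitAddCircle) :
    (avg ρ)^[n] F x y ≤ 2 * n * (avg (lazy ρ))^[2 * n] F x y := by
  have h := choose_mul_iterate_avg_le (ρ := ρ) hF (2 * n) n x y
  have hb : (4 : ℝ) ^ n ≤ 2 * n * (2 * n).choose n := by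
    exact_mod_cast Nat.four_pow_le_two_mul_self_mul_centralBinom n hn
  have h4 : (2 : ℝ) ^ (2 * n) = 4 ^ n := by rw [pow_mul]; norm_num
  rw [h4] at h
  have h0 := (hF.iterate_avg (ρ := ρ) n).nonneg x y
  have h5 : 1 ≤ 2 * n * ((2 * n).choose n / 4 ^ n : ℝ) := by
    rw [← mul_div_assoc, one_le_div (by positivity)]
    exact hb
  calc (avg ρ)^[n] F x y ≤ 2 * n * ((2 * n).choose n / 4 ^ n : ℝ) * (avg ρ)^[n] F x y :=
        le_mul_of_one_le_left h0 h5
    _ = 2 * n * (((2 * n).choose n / 4 ^ n : ℝ) * (avg ρ)^[n] F x y) := by ring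
    _ ≤ _ := mul_le_mul_of_nonneg_left h (by positivity)

end

/-! ### Energy -/

/-- The points `u i` and `v i` are joined by the open connected sets `C i`, which are pairwise
disjoint. -/
structure IsJoined {ι : Type} (C : ι → Set UnitAddCircle) (u v : ι → UnitAddCircle) : Prop where
  isOpen : ∀ i, IsOpen (C i)
  isPreconnected : ∀ i, IsPreconnected (C i)
  left_mem : ∀ i, u i ∈ C i
  right_mem : ∀ i, v i ∈ C i
  disjoint : Pairwise (Function.onFun Disjoint C)

/-- The energy (squared 2-variation) of `F` is at most `c`: for points `u i`, `v i` that are joined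
by pairwise disjoint open connected sets, the squares of the `F (u i) (v i)` add up to at most `c`.
Phrasing this with connected sets rather than with cyclically ordered partitions makes the
invariance under homeomorphisms, orientation preserving or not, immediate. -/
def EnergyLE (F : UnitAddCircle → UnitAddCircle → ℝ) (c : ℝ) : Prop :=
  ∀ (ι : Type) [Fintype ι] (C : ι → Set UnitAddCircle) (u v : ι → UnitAddCircle),
    IsJoined C u v → ∑ i, F (u i) (v i) ^ 2 ≤ c

lemma ofReal_dist_le_hausdorffMeasure {C : Set UnitAddCircle} (hC : IsPreconnected C)
    {u v : UnitAddCircle} (hu : u ∈ C) (hv : v ∈ C) :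
    ENNReal.ofReal (dist u v) ≤ μH[1] C := by
  have hL : LipschitzWith 1 fun z : UnitAddCircle => dist u z := LipschitzWith.dist_right u
  have h1 : Set.Icc 0 (dist u v) ⊆ (fun z => dist u z) '' C :=
    (hC.image _ hL.continuous.continuousOn).Icc_subset ⟨u, hu, dist_self u⟩ ⟨v, hv, rfl⟩
  calc ENNReal.ofReal (dist u v) = volume (Set.Icc 0 (dist u v)) := by simp
    _ = μH[1] (Set.Icc 0 (dist u v)) := by rw [hausdorffMeasure_real]
    _ ≤ μH[1] ((fun z => dist u z) '' C) := measure_mono h1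
    _ ≤ _ := by simpa using hL.hausdorffMeasure_image_le zero_le_one C

lemma hausdorffMeasure_univ_le : μH[1] (Set.univ : Set UnitAddCircle) ≤ 1 := by
  have hL : LipschitzWith 1 fun t : ℝ => (t : UnitAddCircle) := by
    refine LipschitzWith.of_dist_le_mul fun s t => ?_
    rw [dist_eq_norm, dist_eq_norm, NNReal.coe_one, one_mul, ← AddCircle.coe_sub]
    exact QuotientAddGroup.norm_mk_le_norm
  have h1 : (fun t : ℝ => (t : UnitAddCircle)) '' Set.Icc 0 (0 + 1) = Set.univ :=
    AddCircle.coe_image_Icc_eq 1 0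
  calc μH[1] (Set.univ : Set UnitAddCircle)
      ≤ μH[1] (Set.Icc (0 : ℝ) (0 + 1)) := by
        rw [← h1]
        simpa using hL.hausdorffMeasure_image_le zero_le_one (Set.Icc (0 : ℝ) (0 + 1))
    _ = 1 := by rw [hausdorffMeasure_real]; simp

lemma energyLE_dist : EnergyLE (fun x y => dist x y) 1 := by
  intro ι _ C u v hC
  have h1 : ∑ i, ENNReal.ofReal (dist (u i) (v i)) ≤ 1 :=
    calc ∑ i, ENNReal.ofReal (dist (u i) (v i)) ≤ ∑ i, μH[1] (C i) :=
          Finset.sum_le_sum fun i _ => ofReal_dist_le_hausdorffMeasure (hC.isPreconnected i)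
            (hC.left_mem i) (hC.right_mem i)
      _ = μH[1] (⋃ i, C i) := by
          rw [measure_iUnion hC.disjoint fun i => (hC.isOpen i).measurableSet, tsum_fintype]
      _ ≤ μH[1] (Set.univ : Set UnitAddCircle) := measure_mono (Set.subset_univ _)
      _ ≤ 1 := hausdorffMeasure_univ_le
  rw [← ENNReal.ofReal_sum_of_nonneg fun i _ => dist_nonneg, ENNReal.ofReal_le_one] at h1
  refine le_trans (Finset.sum_le_sum fun i _ => ?_) h1
  have h2 := isKernel_dist.le_one (u i) (v i)
  have h3 := isKernel_dist.nonneg (u i) (v i)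
  simp only at h2 h3 ⊢
  nlinarith

lemma EnergyLE.sq_le {F : UnitAddCircle → UnitAddCircle → ℝ} {c : ℝ} (hF : EnergyLE F c)
    (x y : UnitAddCircle) : F x y ^ 2 ≤ c := by
  have h : IsJoined (fun _ : Unit => Set.univ) (fun _ => x) fun _ => y :=
    ⟨fun _ => isOpen_univ, fun _ => isPreconnected_univ, fun _ => Set.mem_univ _,
      fun _ => Set.mem_univ _, fun i j h => (h (Subsingleton.elim i j)).elim⟩
  simpa using hF Unit _ _ _ h

lemma EnergyLE.nonneg {F : UnitAddCircle → UnitAddCircle → ℝ} {c : ℝ} (hF : EnergyLE F c) :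
    0 ≤ c := (sq_nonneg _).trans (hF.sq_le 0 0)

lemma EnergyLE.comp {F : UnitAddCircle → UnitAddCircle → ℝ} {c : ℝ} (hF : EnergyLE F c)
    (h : CircleHomeo) : EnergyLE (fun x y => F (h x) (h y)) c := fun ι _ C _ _ hC =>
  hF ι (fun i => h '' C i) _ _
    ⟨fun i => h.isOpenMap _ (hC.isOpen i),
      fun i => (hC.isPreconnected i).image _ h.continuous.continuousOn,
      fun i => Set.mem_image_of_mem _ (hC.left_mem i),
      fun i => Set.mem_image_of_mem _ (hC.right_mem i),
      fun _ _ hij => (Set.disjoint_image_iff h.injective).2 (hC.disjoint hij)⟩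

/-! ### Ping-pong -/

lemma inter_frontier_nonempty {X : Type*} [TopologicalSpace X] {C R : Set X}
    (hC : IsPreconnected C) (h1 : (C ∩ R).Nonempty) (h2 : (C ∩ Rᶜ).Nonempty) :
    (C ∩ frontier R).Nonempty := by
  by_contra h
  rw [Set.not_nonempty_iff_eq_empty] at h
  have hx : ∀ x ∈ C, x ∉ frontier R := fun x hx hf => (h ▸ ⟨hx, hf⟩ : x ∈ (∅ : Set X))
  have hcov : C ⊆ interior R ∪ (closure R)ᶜ := by
    intro x hxC
    by_cases hR : x ∈ closure R
    · exact Or.inl (by_contra fun hi => hx x hxC ⟨hR, hi⟩)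
    · exact Or.inr hR
  have hdisj : Disjoint (interior R) (closure R)ᶜ :=
    Set.disjoint_compl_right_iff_subset.2 (interior_subset.trans subset_closure)
  obtain ⟨x, hxC, hxR⟩ := h1
  obtain ⟨y, hyC, hyR⟩ := h2
  have hxi : x ∈ interior R := (hcov hxC).resolve_right fun h => h (subset_closure hxR)
  exact hyR (interior_subset (hC.subset_left_of_subset_union isOpen_interior
    isClosed_closure.isOpen_compl hdisj hcov ⟨x, hxC, hxi⟩ hyC))

/-- Data for ping-pong with `k` players on the circle: repelling sets `R j` with at most two
boundary points and attracting arcs `A j`, both pairwise disjoint. -/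
structure PingPong (k : ℕ) where
  /-- the repelling sets -/
  R : Fin k → Set UnitAddCircle
  /-- the attracting arcs -/
  A : Fin k → Set UnitAddCircle
  /-- one boundary point of the repelling set -/
  b : Fin k → UnitAddCircle
  /-- the other boundary point of the repelling set -/
  b' : Fin k → UnitAddCircle
  isOpen_R : ∀ j, IsOpen (R j)
  frontier_R : ∀ j, frontier (R j) ⊆ {b j, b' j}
  disjoint_R : Pairwise (Function.onFun Disjoint R)
  isOpen_A : ∀ j, IsOpen (A j)
  isPreconnected_A : ∀ j, IsPreconnected (A j)
  nonempty_A : ∀ j, (A j).Nonempty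
  disjoint_A : Pairwise (Function.onFun Disjoint A)

/-- The homeomorphisms that play the part of the `j`-th player: they map the complement of the
repelling set into the attracting arc. -/
def PingPong.player {k : ℕ} (D : PingPong k) (j : Fin k) : Set CircleHomeo :=
  {h | Set.MapsTo h (D.R j)ᶜ (D.A j)}

lemma PingPong.isOpen_player {k : ℕ} (D : PingPong k) (j : Fin k) : IsOpen (D.player j) :=
  isOpen_setOf_mapsTo (D.isOpen_R j).isClosed_compl.isCompact (D.isOpen_A j)

open Classical in
/-- The sets `C i` that avoid `R j` are mapped into `A j`, so all their images together, for all
`j`, are disjoint. -/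
lemma sum_avoiding_le
    {k : ℕ} (D : PingPong k) {h : Fin k → CircleHomeo}
    (hh : ∀ j, h j ∈ D.player j) {F : UnitAddCircle → UnitAddCircle → ℝ} {c : ℝ}
    (hF : EnergyLE F c) {ι : Type} [Fintype ι] {C : ι → Set UnitAddCircle}
    {u v : ι → UnitAddCircle} (hC : IsJoined C u v) :
    ∑ j, ∑ i, (if Disjoint (C i) (D.R j) then F (h j (u i)) (h j (v i)) ^ 2 else 0) ≤ c := by
  have hsub : ∀ (j : Fin k) (i : ι), Disjoint (C i) (D.R j) → h j '' C i ⊆ D.A j := by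
    rintro j i hij _ ⟨x, hx, rfl⟩
    exact hh j (Set.disjoint_left.1 hij hx)
  have key := hF {p : Fin k × ι // Disjoint (C p.2) (D.R p.1)} (fun p => h p.1.1 '' C p.1.2)
    (fun p => h p.1.1 (u p.1.2)) (fun p => h p.1.1 (v p.1.2))
    ⟨fun p => (h p.1.1).isOpenMap _ (hC.isOpen _),
      fun p => (hC.isPreconnected _).image _ (h p.1.1).continuous.continuousOn,
      fun p => Set.mem_image_of_mem _ (hC.left_mem _),
      fun p => Set.mem_image_of_mem _ (hC.right_mem _), ?_⟩
  · rw [← Fintype.sum_prod_type' (f := fun (j : Fin k) (i : ι) =>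
      if Disjoint (C i) (D.R j) then F (h j (u i)) (h j (v i)) ^ 2 else 0), ← Finset.sum_filter]
    rwa [← Finset.sum_subtype (Finset.univ.filter fun p : Fin k × ι => Disjoint (C p.2) (D.R p.1))
      (by simp) (fun p => F (h p.1 (u p.2)) (h p.1 (v p.2)) ^ 2)] at key
  · rintro ⟨⟨j, i⟩, hij⟩ ⟨⟨j', i'⟩, hij'⟩ hne
    by_cases hj : j = j'
    · subst hj
      refine (Set.disjoint_image_iff (h j).injective).2 (hC.disjoint ?_)
      rintro rfl
      exact hne rfl
    · exact (D.disjoint_A hj).mono (hsub j i hij) (hsub j' i' hij')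

open Classical in
/-- A set `C i` that meets `R j` but joins two points outside `R j` contains one of the two
boundary points of `R j`. This leaves at most two `i` for each `j`, and the images of their end
points lie in `A j`. -/
lemma sum_crossing_le
    {k : ℕ} (D : PingPong k) {h : Fin k → CircleHomeo}
    (hh : ∀ j, h j ∈ D.player j) {F : UnitAddCircle → UnitAddCircle → ℝ} {c : ℝ}
    (hF : EnergyLE F c) {ι : Type} [Fintype ι] {C : ι → Set UnitAddCircle}
    {u v : ι → UnitAddCircle} (hC : IsJoined C u v) :
    ∑ j, ∑ i, (if ¬ Disjoint (C i) (D.R j) ∧ u i ∉ D.R j ∧ v i ∉ D.R j then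
      F (h j (u i)) (h j (v i)) ^ 2 else 0) ≤ 2 * c := by
  let J : Fin k → Finset ι := fun j =>
    Finset.univ.filter fun i => ¬ Disjoint (C i) (D.R j) ∧ u i ∉ D.R j ∧ v i ∉ D.R j
  have hcard : ∀ j, (J j).card ≤ 2 := by
    intro j
    have hex : ∀ i ∈ J j, ∃ z, z ∈ C i ∧ z ∈ ({D.b j, D.b' j} : Set UnitAddCircle) := by
      intro i hi
      obtain ⟨h1, h2, -⟩ := (Finset.mem_filter.1 hi).2
      obtain ⟨z, hz, hz'⟩ := inter_frontier_nonempty (hC.isPreconnected i)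
        (Set.not_disjoint_iff_nonempty_inter.1 h1) ⟨u i, hC.left_mem i, h2⟩
      exact ⟨z, hz, D.frontier_R j hz'⟩
    choose! z hzC hzb using hex
    calc (J j).card ≤ ({D.b j, D.b' j} : Finset UnitAddCircle).card := by
          refine Finset.card_le_card_of_injOn z (fun i hi => by simpa using hzb i hi) ?_
          intro i hi i' hi' hz
          by_contra hne
          exact Set.disjoint_left.1 (hC.disjoint hne) (hzC i hi) (hz ▸ hzC i' hi')
      _ ≤ 2 := Finset.card_le_two
  have hpair : ∀ j, ∃ x ∈ D.A j, ∃ y ∈ D.A j,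
      ∑ i ∈ J j, F (h j (u i)) (h j (v i)) ^ 2 ≤ 2 * F x y ^ 2 := by
    intro j
    rcases (J j).eq_empty_or_nonempty with he | hne
    · obtain ⟨x, hx⟩ := D.nonempty_A j
      exact ⟨x, hx, x, hx, by rw [he, Finset.sum_empty]; positivity⟩
    · obtain ⟨m, hm, hmax⟩ := (J j).exists_max_image (fun i => F (h j (u i)) (h j (v i)) ^ 2) hne
      obtain ⟨-, h2, h3⟩ := (Finset.mem_filter.1 hm).2
      refine ⟨_, hh j h2, _, hh j h3, (Finset.sum_le_card_nsmul _ _ _ hmax).trans ?_⟩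
      rw [nsmul_eq_mul]
      exact mul_le_mul_of_nonneg_right (by exact_mod_cast hcard j) (sq_nonneg _)
  choose x hx y hy hxy using hpair
  calc _ = ∑ j, ∑ i ∈ J j, F (h j (u i)) (h j (v i)) ^ 2 := by
        refine Finset.sum_congr rfl fun j _ => ?_
        rw [Finset.sum_filter]
    _ ≤ ∑ j, 2 * F (x j) (y j) ^ 2 := Finset.sum_le_sum fun j _ => hxy j
    _ = 2 * ∑ j, F (x j) (y j) ^ 2 := by rw [Finset.mul_sum]
    _ ≤ 2 * c := by
        gcongr
        exact hF (Fin k) D.A x y ⟨D.isOpen_A, D.isPreconnected_A, hx, hy, D.disjoint_A⟩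

lemma card_mem_or_mem_le {k : ℕ} (D : PingPong k) (x y : UnitAddCircle)
    [DecidablePred fun j => x ∈ D.R j ∨ y ∈ D.R j] :
    (Finset.univ.filter fun j => x ∈ D.R j ∨ y ∈ D.R j).card ≤ 2 := by
  classical
  have h1 : ∀ z : UnitAddCircle, (Finset.univ.filter fun j => z ∈ D.R j).card ≤ 1 := by
    intro z
    refine Finset.card_le_one.2 fun i hi j hj => ?_
    by_contra hne
    exact Set.disjoint_left.1 (D.disjoint_R hne) (Finset.mem_filter.1 hi).2
      (Finset.mem_filter.1 hj).2
  have h2 : (Finset.univ.filter fun j => x ∈ D.R j ∨ y ∈ D.R j) =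
      (Finset.univ.filter fun j => x ∈ D.R j) ∪ Finset.univ.filter fun j => y ∈ D.R j := by
    ext j
    simp
  rw [h2]
  exact (Finset.card_union_le _ _).trans (by linarith [h1 x, h1 y])

/-- The ping-pong estimate: the sum of the translates of `F` by `k` players has energy `O(k)`,
whereas `k` translates by one and the same homeomorphism would give `k ^ 2`. -/
lemma sum_sq_sum_players_le
    {k : ℕ} (D : PingPong k) {h : Fin k → CircleHomeo}
    (hh : ∀ j, h j ∈ D.player j) {F : UnitAddCircle → UnitAddCircle → ℝ} {c : ℝ}
    (hF : EnergyLE F c) {ι : Type} [Fintype ι] {C : ι → Set UnitAddCircle}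
    {u v : ι → UnitAddCircle} (hC : IsJoined C u v) :
    ∑ i, (∑ j, F (h j (u i)) (h j (v i))) ^ 2 ≤ 10 * k * c := by
  classical
  set f : ι → Fin k → ℝ := fun i j => F (h j (u i)) (h j (v i)) with hf
  let I : ι → Finset (Fin k) := fun i => Finset.univ.filter fun j => u i ∈ D.R j ∨ v i ∈ D.R j
  have hI : ∀ i, (∑ j, f i j) ^ 2 ≤ 4 * ∑ j, f i j ^ 2 +
      2 * k * ∑ j, (if u i ∈ D.R j ∨ v i ∈ D.R j then 0 else f i j ^ 2) := by
    intro i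
    have e1 : ∑ j, f i j = ∑ j ∈ I i, f i j + ∑ j ∈ (I i)ᶜ, f i j :=
      (Finset.sum_add_sum_compl _ _).symm
    have e2 : (∑ j ∈ I i, f i j) ^ 2 ≤ 2 * ∑ j, f i j ^ 2 :=
      calc (∑ j ∈ I i, f i j) ^ 2 ≤ (I i).card * ∑ j ∈ I i, f i j ^ 2 := sq_sum_le_card_mul_sum_sq
        _ ≤ 2 * ∑ j, f i j ^ 2 := by
          gcongr
          · exact_mod_cast card_mem_or_mem_le D (u i) (v i)
          · exact Finset.subset_univ _
    have e3 : (∑ j ∈ (I i)ᶜ, f i j) ^ 2 ≤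
        k * ∑ j, (if u i ∈ D.R j ∨ v i ∈ D.R j then 0 else f i j ^ 2) :=
      calc (∑ j ∈ (I i)ᶜ, f i j) ^ 2 ≤ (I i)ᶜ.card * ∑ j ∈ (I i)ᶜ, f i j ^ 2 :=
            sq_sum_le_card_mul_sum_sq
        _ ≤ k * ∑ j ∈ (I i)ᶜ, f i j ^ 2 := by
          gcongr
          simpa using Finset.card_le_univ (I i)ᶜ
        _ = k * ∑ j, (if u i ∈ D.R j ∨ v i ∈ D.R j then 0 else f i j ^ 2) := by
          congr 1
          rw [Finset.compl_filter, Finset.sum_filter]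
          exact Finset.sum_congr rfl fun j _ => by split_ifs <;> rfl
    rw [e1]
    nlinarith [sq_nonneg (∑ j ∈ I i, f i j - ∑ j ∈ (I i)ᶜ, f i j)]
  have h1 : ∑ i, ∑ j, f i j ^ 2 ≤ k * c := by
    rw [Finset.sum_comm]
    calc ∑ j, ∑ i, f i j ^ 2 ≤ ∑ _j : Fin k, c :=
          Finset.sum_le_sum fun j _ => hF.comp (h j) ι C u v hC
      _ = k * c := by simp
  have h2 : ∑ i, ∑ j, (if u i ∈ D.R j ∨ v i ∈ D.R j then 0 else f i j ^ 2) ≤ 3 * c := by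
    have h3 := sum_avoiding_le D hh hF hC
    have h4 := sum_crossing_le D hh hF hC
    have h5 : ∑ j, ∑ i, (if u i ∈ D.R j ∨ v i ∈ D.R j then 0 else f i j ^ 2) ≤
        ∑ j, ∑ i, ((if Disjoint (C i) (D.R j) then f i j ^ 2 else 0) +
          (if ¬ Disjoint (C i) (D.R j) ∧ u i ∉ D.R j ∧ v i ∉ D.R j then f i j ^ 2 else 0)) := by
      refine Finset.sum_le_sum fun j _ => Finset.sum_le_sum fun i _ => ?_
      have := sq_nonneg (f i j)
      by_cases hD : Disjoint (C i) (D.R j)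
      · by_cases hm : u i ∈ D.R j ∨ v i ∈ D.R j <;> simp [hD, hm, this]
      · by_cases hm : u i ∈ D.R j ∨ v i ∈ D.R j
        · simp only [hm, if_true, hD, if_false]
          positivity
        · have hm' := not_or.1 hm
          simp [hD, hm']
    simp only [Finset.sum_add_distrib] at h5
    rw [Finset.sum_comm]
    linarith
  calc ∑ i, (∑ j, f i j) ^ 2 ≤ ∑ i, (4 * ∑ j, f i j ^ 2 +
        2 * k * ∑ j, (if u i ∈ D.R j ∨ v i ∈ D.R j then 0 else f i j ^ 2)) :=
        Finset.sum_le_sum fun i _ => hI i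
    _ = 4 * ∑ i, ∑ j, f i j ^ 2 +
        2 * k * ∑ i, ∑ j, (if u i ∈ D.R j ∨ v i ∈ D.R j then 0 else f i j ^ 2) := by
        rw [Finset.sum_add_distrib, Finset.mul_sum, Finset.mul_sum]
    _ ≤ 4 * (k * c) + 2 * k * (3 * c) := by gcongr
    _ = 10 * k * c := by ring

/-! ### Averages over random homeomorphisms -/

/-- Duality for the energy of an average: it suffices to bound the means of the sums
`∑ i, w i * F (g (u i)) (g (v i))` with fixed weights `w`. The trivial bound is the case `q = 1`. -/
lemma energyLE_avg_of_integral_le {F : UnitAddCircle → UnitAddCircle → ℝ} (hK : IsKernel F)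
    {ρ : Measure CircleHomeo} [IsProbabilityMeasure ρ] {c q : ℝ} (hc0 : 0 ≤ c) (hq : 0 ≤ q)
    (H : ∀ (ι : Type) [Fintype ι] (C : ι → Set UnitAddCircle) (u v : ι → UnitAddCircle),
      IsJoined C u v → ∀ w : ι → ℝ,
      ∫ g, ∑ i, w i * F (g (u i)) (g (v i)) ∂ρ ≤ q * (√(∑ i, w i ^ 2) * √c)) :
    EnergyLE (avg ρ F) (q ^ 2 * c) := by
  intro ι _ C u v hC
  -- the weights that realize the norm are the values of the average themselves
  set S := ∑ i, avg ρ F (u i) (v i) ^ 2 with hS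
  have hS0 : 0 ≤ S := Finset.sum_nonneg fun i _ => sq_nonneg _
  have h1 := H ι C u v hC fun i => avg ρ F (u i) (v i)
  have h2 : ∫ g, ∑ i, avg ρ F (u i) (v i) * F (g (u i)) (g (v i)) ∂ρ = S := by
    rw [integral_finsetSum _ fun i _ => (hK.integrable_comp _ _).const_mul _]
    refine Finset.sum_congr rfl fun i _ => ?_
    rw [integral_const_mul, sq]
    rfl
  rw [h2, ← hS] at h1
  have h3 : √S ≤ q * √c := by
    rcases hS0.eq_or_lt with h0 | h0
    · rw [← h0, Real.sqrt_zero]; positivity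
    · have : 0 < √S := Real.sqrt_pos.2 h0
      refine le_of_mul_le_mul_left ?_ this
      rw [Real.mul_self_sqrt hS0]
      linarith
  calc S = √S ^ 2 := (Real.sq_sqrt hS0).symm
    _ ≤ (q * √c) ^ 2 := by gcongr
    _ = q ^ 2 * c := by rw [mul_pow, Real.sq_sqrt hc0]

lemma sum_mul_le_sqrt_mul_sqrt {ι : Type*} (s : Finset ι) (f g : ι → ℝ) {b : ℝ}
    (hb : ∑ i ∈ s, g i ^ 2 ≤ b) :
    ∑ i ∈ s, f i * g i ≤ √(∑ i ∈ s, f i ^ 2) * √b := by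
  rw [← Real.sqrt_mul (Finset.sum_nonneg fun i _ => sq_nonneg _)]
  refine Real.le_sqrt_of_sq_le ((Finset.sum_mul_sq_le_sq_mul_sq s f g).trans ?_)
  exact mul_le_mul_of_nonneg_left hb (Finset.sum_nonneg fun i _ => sq_nonneg _)

lemma EnergyLE.avg {F : UnitAddCircle → UnitAddCircle → ℝ} (hK : IsKernel F)
    {ρ : Measure CircleHomeo} [IsProbabilityMeasure ρ] {c : ℝ} (hF : EnergyLE F c) :
    EnergyLE (avg ρ F) c := by
  have := energyLE_avg_of_integral_le hK (ρ := ρ) hF.nonneg zero_le_one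
    fun ι _ C u v hC w => by
      have h := integral_mono (μ := ρ)
        (integrable_finsetSum Finset.univ fun i _ => (hK.integrable_comp (u i) (v i)).const_mul (w i))
        (integrable_const (√(∑ i, w i ^ 2) * √c))
        fun g => sum_mul_le_sqrt_mul_sqrt Finset.univ w _ (hF.comp g ι C u v hC)
      simpa using h
  simpa using this

/-- If each of forty players turns up with probability at least `p`, averaging contracts the
energy. Indeed a weighted sum of values of `F ∘ g` cannot be large for one `g` from each class of
players, so it is at most half of its trivial bound on some class. -/
lemma EnergyLE.avg_of_pingPong {F : UnitAddCircle → UnitAddCircle → ℝ} (hK : IsKernel F)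
    {ρ : Measure CircleHomeo} [IsProbabilityMeasure ρ] {c p : ℝ} (hF : EnergyLE F c)
    (D : PingPong 40) (hp : ∀ j, p ≤ ρ.real (D.player j)) :
    EnergyLE (CircleHomeo.avg ρ F) ((1 - p / 2) ^ 2 * c) := by
  have hp1 : p ≤ 1 := (hp 0).trans measureReal_le_one
  refine energyLE_avg_of_integral_le hK hF.nonneg (by linarith)
    fun ι _ C u v hC w => ?_
  set M := √(∑ i, w i ^ 2) * √c with hM
  have hM0 : 0 ≤ M := by positivity
  set φ : CircleHomeo → ℝ := fun g => ∑ i, w i * F (g (u i)) (g (v i)) with hφ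
  have hφM : ∀ g, φ g ≤ M := fun g =>
    sum_mul_le_sqrt_mul_sqrt Finset.univ w _ (hF.comp g ι C u v hC)
  have hφi : Integrable φ ρ :=
    integrable_finsetSum Finset.univ fun i _ => (hK.integrable_comp (u i) (v i)).const_mul (w i)
  obtain ⟨j, hj⟩ : ∃ j, ∀ g ∈ D.player j, φ g ≤ M / 2 := by
    by_contra! hcon
    -- otherwise one player from each class violates the ping-pong estimate
    choose h hh hlarge using hcon
    have h1 := sum_mul_le_sqrt_mul_sqrt Finset.univ w _
      (sum_sq_sum_players_le D hh hF hC)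
    -- the square root of `10 * 40 = 20 ^ 2` is half the number of players
    have h2 : √(10 * (40 : ℕ) * c) = 20 * √c := by
      rw [show (10 * (40 : ℕ) * c : ℝ) = 20 ^ 2 * c by norm_num, Real.sqrt_mul (by positivity),
        Real.sqrt_sq (by norm_num)]
    rw [h2] at h1
    have h3 : ∑ i, w i * ∑ j, F (h j (u i)) (h j (v i)) = ∑ j, φ (h j) := by
      simp only [hφ, Finset.mul_sum]
      exact Finset.sum_comm
    have h4 : ∑ _j : Fin 40, M / 2 < ∑ j, φ (h j) :=
      Finset.sum_lt_sum_of_nonempty Finset.univ_nonempty fun j _ => hlarge j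
    have h5 : ∑ _j : Fin 40, M / 2 = 20 * M := by simp; ring
    rw [h3] at h1
    have : √(∑ i, w i ^ 2) * (20 * √c) = 20 * M := by rw [hM]; ring
    linarith
  have hm : MeasurableSet (D.player j) := (D.isOpen_player j).measurableSet
  have hle : ∀ g, φ g ≤ M - (D.player j).indicator (fun _ => M / 2) g := by
    intro g
    by_cases hg : g ∈ D.player j
    · rw [Set.indicator_of_mem hg]
      linarith [hj g hg]
    · rw [Set.indicator_of_notMem hg]
      linarith [hφM g]
  have hind : Integrable ((D.player j).indicator fun _ => M / 2) ρ :=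
    (integrable_const _).indicator hm
  calc ∫ g, φ g ∂ρ ≤ ∫ g, (M - (D.player j).indicator (fun _ => M / 2) g) ∂ρ :=
        integral_mono hφi ((integrable_const _).sub hind) hle
    _ = M - ρ.real (D.player j) * (M / 2) := by
        rw [integral_sub (integrable_const _) hind, integral_indicator_const _ hm]
        simp
    _ ≤ M - p * (M / 2) := by gcongr; exact hp j
    _ = (1 - p / 2) * M := by ring

open Filter Topology Metric

/-! ### Arcs -/

lemma ball_coe_eq_image (t δ : ℝ) :
    ball (t : UnitAddCircle) δ = (fun s : ℝ => (s : UnitAddCircle)) '' Set.Ioo (t - δ) (t + δ) := by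
  ext z
  rw [mem_ball, dist_eq_norm, QuotientAddGroup.norm_lt_iff]
  constructor
  · rintro ⟨m, hm, hlt⟩
    rw [Real.norm_eq_abs, abs_lt] at hlt
    refine ⟨t + m, ⟨by linarith, by linarith⟩, ?_⟩
    change ((t + m : ℝ) : UnitAddCircle) = z
    rw [AddCircle.coe_add]
    rw [show (m : UnitAddCircle) = z - t from hm]
    abel
  · rintro ⟨s, ⟨h1, h2⟩, rfl⟩
    exact ⟨s - t, AddCircle.coe_sub _ _ _, by rw [Real.norm_eq_abs, abs_lt]; constructor <;> linarith⟩

lemma continuous_coe : Continuous fun s : ℝ => (s : UnitAddCircle) :=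
  AddCircle.continuous_mk' 1

lemma isPreconnected_ball (z : UnitAddCircle) (δ : ℝ) : IsPreconnected (ball z δ) := by
  obtain ⟨t, rfl⟩ := QuotientAddGroup.mk_surjective z
  have := ball_coe_eq_image t δ
  exact this ▸ isPreconnected_Ioo.image _ continuous_coe.continuousOn

lemma isClosed_image_Icc (s t : ℝ) :
    IsClosed ((fun s : ℝ => (s : UnitAddCircle)) '' Set.Icc s t) :=
  (isCompact_Icc.image continuous_coe).isClosed

lemma mem_image_Ioo_or_of_mem_image_Icc {s t : ℝ} {z : UnitAddCircle}
    (hz : z ∈ (fun s : ℝ => (s : UnitAddCircle)) '' Set.Icc s t) :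
    z ∈ (fun s : ℝ => (s : UnitAddCircle)) '' Set.Ioo s t ∨ z = s ∨ z = t := by
  obtain ⟨r, ⟨h1, h2⟩, rfl⟩ := hz
  rcases h1.eq_or_lt with rfl | h1
  · exact Or.inr (Or.inl rfl)
  rcases h2.eq_or_lt with rfl | h2
  · exact Or.inr (Or.inr rfl)
  exact Or.inl ⟨r, ⟨h1, h2⟩, rfl⟩

lemma exists_frontier_ball_subset (z : UnitAddCircle) (δ : ℝ) :
    ∃ b b' : UnitAddCircle, frontier (ball z δ) ⊆ {b, b'} := by
  obtain ⟨t, rfl⟩ := QuotientAddGroup.mk_surjective z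
  refine ⟨(t - δ : ℝ), (t + δ : ℝ), fun y hy => ?_⟩
  have h1 := ball_coe_eq_image t δ
  change ball (QuotientAddGroup.mk t : UnitAddCircle) δ = _ at h1
  rw [isOpen_ball.frontier_eq, h1] at hy
  have h2 := closure_minimal (Set.image_mono Set.Ioo_subset_Icc_self)
    (isClosed_image_Icc (t - δ) (t + δ)) hy.1
  exact (mem_image_Ioo_or_of_mem_image_Icc h2).resolve_left hy.2

lemma isPreconnected_compl_ball (z : UnitAddCircle) {δ : ℝ} (h0 : 0 < δ) (h1 : δ ≤ 1 / 4) :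
    IsPreconnected (ball z δ)ᶜ := by
  obtain ⟨t, rfl⟩ := QuotientAddGroup.mk_surjective z
  have h : (ball (t : UnitAddCircle) δ)ᶜ =
      (fun s : ℝ => (s : UnitAddCircle)) '' Set.Icc (t + δ) (t + 1 - δ) := by
    rw [ball_coe_eq_image]
    ext y
    constructor
    · intro hy
      have hy' : y ∈ (fun s : ℝ => (s : UnitAddCircle)) '' Set.Ioc (t - δ) (t - δ + 1) := by
        have := AddCircle.coe_image_Ioc_eq (1 : ℝ) (t - δ)
        exact this ▸ Set.mem_univ y
      obtain ⟨r, ⟨hr1, hr2⟩, rfl⟩ := hy'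
      refine ⟨r, ⟨?_, by linarith⟩, rfl⟩
      by_contra! hlt
      exact hy ⟨r, ⟨hr1, hlt⟩, rfl⟩
    · rintro ⟨r, ⟨hr1, hr2⟩, rfl⟩ ⟨r', ⟨hr1', hr2'⟩, hrr⟩
      have : r' = r := (AddCircle.coe_eq_coe_iff_of_mem_Ioc (p := 1) (a := t - δ)
        ⟨hr1', by linarith⟩ ⟨by linarith, by linarith⟩).1 hrr
      linarith
  exact h ▸ isPreconnected_Icc.image _ continuous_coe.continuousOn

/-! ### Contraction by proximality -/

variable {G : Subsemigroup CircleHomeo}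

lemma IsProximal.exists_dist_lt (hG : IsProximal (G : Set CircleHomeo)) (x y : UnitAddCircle)
    {ε : ℝ} (hε : 0 < ε) : ∃ g ∈ G, dist (g x) (g y) < ε := by
  have h : ⨅ g ∈ (G : Set CircleHomeo), edist (g x) (g y) < ENNReal.ofReal ε := by
    rw [hG x y]
    exact ENNReal.ofReal_pos.2 hε
  simp only [iInf_lt_iff] at h
  obtain ⟨g, hg, hlt⟩ := h
  rw [edist_dist, ENNReal.ofReal_lt_ofReal_iff hε] at hlt
  exact ⟨g, hg, hlt⟩

/-- Finite sets can be contracted: a new point `z` is treated by following elements that contract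
the old points to `p` and move `z` to `q`, in the limit, by one that brings `p` and `q` together. -/
lemma IsProximal.exists_contract_finset (hG : IsProximal (G : Set CircleHomeo))
    (s : Finset UnitAddCircle) {ε : ℝ} (hε : 0 < ε) :
    ∃ g ∈ G, ∃ p, ∀ x ∈ s, dist (g x) p < ε := by
  classical
  induction s using Finset.induction_on generalizing ε with
  | empty =>
    obtain ⟨g, hg, -⟩ := hG.exists_dist_lt 0 0 hε
    exact ⟨g, hg, 0, by simp⟩
  | insert z s hz ih =>
    choose g hg p hp using fun n : ℕ => ih (ε := 1 / ((n : ℝ) + 1)) (by positivity)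
    obtain ⟨⟨a, b⟩, φ, hφ, hlim⟩ := CompactSpace.tendsto_subseq fun n => (p n, g n z)
    have ha : Tendsto (fun n => p (φ n)) atTop (𝓝 a) :=
      (continuous_fst.tendsto (a, b)).comp hlim
    have hb : Tendsto (fun n => g (φ n) z) atTop (𝓝 b) :=
      (continuous_snd.tendsto (a, b)).comp hlim
    have hs : ∀ x ∈ s, Tendsto (fun n => g (φ n) x) atTop (𝓝 a) := by
      intro x hx
      refine ha.congr_dist (squeeze_zero (fun _ => dist_nonneg) (fun n => ?_)
        (tendsto_one_div_add_atTop_nhds_zero_nat.comp hφ.tendsto_atTop))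
      rw [dist_comm]
      exact (hp (φ n) x hx).le
    obtain ⟨h, hh, hab⟩ := hG.exists_dist_lt a b (half_pos hε)
    have h1 : ∀ᶠ n in atTop, ∀ x ∈ s, dist (h (g (φ n) x)) (h a) < ε := by
      rw [Filter.eventually_all_finset]
      intro x hx
      exact ((h.continuous.tendsto a).comp (hs x hx)).eventually (ball_mem_nhds _ hε)
    have h2 : ∀ᶠ n in atTop, dist (h (g (φ n) z)) (h b) < ε / 2 :=
      ((h.continuous.tendsto b).comp hb).eventually (ball_mem_nhds _ (half_pos hε))
    obtain ⟨n, hn1, hn2⟩ := (h1.and h2).exists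
    refine ⟨h * g (φ n), G.mul_mem hh (hg _), h a, fun x hx => ?_⟩
    rcases Finset.mem_insert.1 hx with rfl | hx
    · calc dist ((h * g (φ n)) x) (h a) ≤ dist (h (g (φ n) x)) (h b) + dist (h b) (h a) :=
            dist_triangle _ _ _
        _ < ε := by rw [dist_comm (h b)]; linarith
    · exact hn1 x hx

/-- If `g` moves a fine net into a small arc `B`, the connected complement of `B` is the image of a
part of a single gap of the net. -/
lemma IsProximal.exists_mapsTo_ball (hG : IsProximal (G : Set CircleHomeo)) {ε : ℝ} (hε : 0 < ε)
    (hε' : ε ≤ 1 / 4) : ∃ g ∈ G, ∃ r a, Set.MapsTo g (ball r ε)ᶜ (ball a ε) := by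
  obtain ⟨n, hn⟩ := exists_nat_one_div_lt hε
  set N : ℝ := (n : ℝ) + 1 with hN
  have hN0 : 0 < N := by positivity
  obtain ⟨g, hg, p, hp⟩ := hG.exists_contract_finset
    ((Finset.range (n + 2)).image fun k : ℕ => ((k / N : ℝ) : UnitAddCircle)) hε
  have hnet : ∀ k < n + 2, g ((k / N : ℝ) : UnitAddCircle) ∈ ball p ε := fun k hk =>
    hp _ (Finset.mem_image_of_mem _ (Finset.mem_range.2 hk))
  by_cases hB : ∀ z, g z ∈ ball p ε
  · exact ⟨g, hg, 0, p, fun z _ => hB z⟩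
  push Not at hB
  obtain ⟨w, hw⟩ := hB
  have hw' : w ∈ (fun s : ℝ => (s : UnitAddCircle)) '' Set.Ico 0 (0 + 1) := by
    have := AddCircle.coe_image_Ico_eq (1 : ℝ) 0
    exact this ▸ Set.mem_univ w
  obtain ⟨r, ⟨hr0, hr1⟩, rfl⟩ := hw'
  set k := ⌊r * N⌋₊ with hk
  have hk1 : (k : ℝ) ≤ r * N := Nat.floor_le (by positivity)
  have hk2 : r * N < k + 1 := Nat.lt_floor_add_one _
  have hkn : k < n + 1 := by
    have : (k : ℝ) < (n + 1 : ℕ) := by push_cast; nlinarith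
    exact_mod_cast this
  set R := (fun s : ℝ => (s : UnitAddCircle)) '' Set.Ioo (k / N) ((k + 1) / N) with hR
  set R' := (fun s : ℝ => (s : UnitAddCircle)) '' Set.Icc (k / N) ((k + 1) / N) with hR'
  have hend : ∀ z ∈ R', z ∈ R ∨ g z ∈ ball p ε := by
    intro z hz
    rcases mem_image_Ioo_or_of_mem_image_Icc hz with h | rfl | rfl
    · exact Or.inl h
    · exact Or.inr (hnet k (by omega))
    · exact Or.inr (by exact_mod_cast hnet (k + 1) (by omega))
  have hRo : IsOpen R := QuotientAddGroup.isOpenMap_coe _ isOpen_Ioo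
  have hRR : R ⊆ R' := Set.image_mono Set.Ioo_subset_Icc_self
  have hQ : IsPreconnected (g.symm '' (ball p ε)ᶜ) :=
    (isPreconnected_compl_ball p hε hε').image _ g.symm.continuous.continuousOn
  have hQmem : ∀ z, z ∈ g.symm '' (ball p ε)ᶜ ↔ g z ∉ ball p ε := by
    intro z
    constructor
    · rintro ⟨y, hy, rfl⟩
      simpa using hy
    · exact fun h => ⟨g z, h, g.symm_apply_apply z⟩
  have hwR : (r : UnitAddCircle) ∈ R := (hend _ ⟨r, ⟨by rwa [div_le_iff₀ hN0],
    by rw [le_div_iff₀ hN0]; exact hk2.le⟩, rfl⟩).resolve_right hw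
  have hQR : g.symm '' (ball p ε)ᶜ ⊆ R := by
    refine hQ.subset_left_of_subset_union hRo (isClosed_image_Icc _ _).isOpen_compl
      (Set.disjoint_compl_right_iff_subset.2 hRR) (fun z hz => ?_) ⟨_, (hQmem _).2 hw, hwR⟩
    by_cases hzR : z ∈ R'
    · exact Or.inl ((hend z hzR).resolve_right ((hQmem z).1 hz))
    · exact Or.inr hzR
  have hRball : R ⊆ ball ((k / N : ℝ) : UnitAddCircle) ε := by
    rw [ball_coe_eq_image]
    refine Set.image_mono (Set.Ioo_subset_Ioo (by linarith) ?_)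
    rw [add_div]
    linarith
  refine ⟨g, hg, ((k / N : ℝ) : UnitAddCircle), p, fun z hz => ?_⟩
  by_contra hgz
  exact hz (hRball (hQR ((hQmem z).2 hgz)))

/-- A repelling point `r` and an attracting point `a` of the semigroup. -/
lemma IsProximal.exists_repelling_attracting (hG : IsProximal (G : Set CircleHomeo)) :
    ∃ r a : UnitAddCircle, ∀ V ∈ 𝓝 r, ∀ W ∈ 𝓝 a, ∃ g ∈ G, Set.MapsTo g Vᶜ W := by
  choose g hg r a h using fun n : ℕ => hG.exists_mapsTo_ball (ε := 1 / ((n : ℝ) + 1) / 4)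
    (by positivity) (by
      gcongr
      rw [div_le_one (by positivity)]
      linarith [n.cast_nonneg (α := ℝ)])
  obtain ⟨⟨r₀, a₀⟩, φ, hφ, hlim⟩ := CompactSpace.tendsto_subseq fun n => (r n, a n)
  have hr : Tendsto (fun n => r (φ n)) atTop (𝓝 r₀) :=
    (continuous_fst.tendsto (r₀, a₀)).comp hlim
  have ha : Tendsto (fun n => a (φ n)) atTop (𝓝 a₀) :=
    (continuous_snd.tendsto (r₀, a₀)).comp hlim
  refine ⟨r₀, a₀, fun V hV W hW => ?_⟩
  obtain ⟨ε, hε, hVε⟩ := Metric.mem_nhds_iff.1 hV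
  obtain ⟨η, hη, hWη⟩ := Metric.mem_nhds_iff.1 hW
  have h0 : Tendsto (fun n : ℕ => 1 / ((φ n : ℝ) + 1) / 4) atTop (𝓝 0) := by
    simpa using (tendsto_one_div_add_atTop_nhds_zero_nat.comp hφ.tendsto_atTop).div_const (4 : ℝ)
  obtain ⟨n, ⟨h1, h2⟩, h3, h4⟩ := (((hr.eventually (ball_mem_nhds _ (half_pos hε))).and
    (ha.eventually (ball_mem_nhds _ (half_pos hη)))).and
    ((h0.eventually (gt_mem_nhds (half_pos hε))).and
      (h0.eventually (gt_mem_nhds (half_pos hη))))).exists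
  have hsubV : ball (r (φ n)) (1 / ((φ n : ℝ) + 1) / 4) ⊆ V :=
    (ball_subset_ball' (by linarith)).trans hVε
  have hsubW : ball (a (φ n)) (1 / ((φ n : ℝ) + 1) / 4) ⊆ W :=
    (ball_subset_ball' (by linarith)).trans hWη
  exact ⟨g (φ n), hg _, fun z hz => hsubW (h (φ n) fun hz' => hz (hsubV hz'))⟩

lemma not_mapsTo_of_finite (hG : IsProximal (G : Set CircleHomeo))
    (hfix : ¬ HasGlobalFixedPoint (G : Set CircleHomeo)) {F : Set UnitAddCircle} (hF : F.Finite)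
    (hne : F.Nonempty) : ¬ ∀ g ∈ G, Set.MapsTo g F F := by
  intro hmaps
  rcases F.subsingleton_or_nontrivial with hs | ⟨x, hx, y, hy, hxy⟩
  · obtain ⟨x, hx⟩ := hne
    exact hfix ⟨x, fun g hg => hs (hmaps g hg hx) hx⟩
  · have hpos : 0 < F.infsep := hF.infsep_pos_iff_nontrivial.2 ⟨x, hx, y, hy, hxy⟩
    obtain ⟨g, hg, hlt⟩ := hG.exists_dist_lt x y hpos
    exact hlt.not_ge (Set.infsep_le_dist_of_mem (hmaps g hg hx) (hmaps g hg hy)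
      (g.injective.ne hxy))

lemma IsProximal.nonempty (hG : IsProximal (G : Set CircleHomeo)) :
    (G : Set CircleHomeo).Nonempty := by
  obtain ⟨g, hg, -⟩ := hG.exists_dist_lt 0 0 one_pos
  exact ⟨g, hg⟩

lemma infinite_orbit (hG : IsProximal (G : Set CircleHomeo))
    (hfix : ¬ HasGlobalFixedPoint (G : Set CircleHomeo)) (x : UnitAddCircle) :
    {y | ∃ g ∈ G, g x = y}.Infinite := by
  intro hfin
  obtain ⟨g₀, hg₀⟩ := hG.nonempty
  refine not_mapsTo_of_finite hG hfix hfin ⟨g₀ x, g₀, hg₀, rfl⟩ ?_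
  rintro g hg _ ⟨h, hh, rfl⟩
  exact ⟨g * h, G.mul_mem hg hh, rfl⟩

lemma infinite_inverse_orbit (hG : IsProximal (G : Set CircleHomeo))
    (hfix : ¬ HasGlobalFixedPoint (G : Set CircleHomeo)) (x : UnitAddCircle) :
    {y | ∃ g ∈ G, g y = x}.Infinite := by
  intro hfin
  obtain ⟨g₀, hg₀⟩ := hG.nonempty
  refine not_mapsTo_of_finite hG hfix hfin ⟨g₀.symm x, g₀, hg₀, g₀.apply_symm_apply x⟩ ?_
  intro g hg y hy
  have hinv : g.symm '' {y | ∃ g ∈ G, g y = x} ⊆ {y | ∃ g ∈ G, g y = x} := by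
    rintro _ ⟨z, ⟨h, hh, rfl⟩, rfl⟩
    refine ⟨h * g, G.mul_mem hh hg, ?_⟩
    change h (g (g.symm z)) = h z
    rw [g.apply_symm_apply]
  -- the inverse of `g` maps the finite set injectively into itself, hence onto itself
  have heq := Set.eq_of_subset_of_ncard_le hinv
    (Set.ncard_image_of_injective _ g.symm.injective).ge hfin
  obtain ⟨z, hz, rfl⟩ := heq.ge hy
  rwa [g.apply_symm_apply]

lemma eventually_disjoint_balls {k : ℕ} {f : Fin k → UnitAddCircle} (hf : f.Injective) :
    ∀ᶠ δ : ℝ in 𝓝[>] 0, Pairwise (Function.onFun Disjoint fun j => ball (f j) δ) := by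
  have h : ∀ i j, ∀ᶠ δ : ℝ in 𝓝[>] 0, i ≠ j → δ + δ ≤ dist (f i) (f j) := by
    intro i j
    by_cases hij : i = j
    · simp [hij]
    · have hpos : 0 < dist (f i) (f j) := dist_pos.2 (hf.ne hij)
      filter_upwards [Ioo_mem_nhdsGT (half_pos hpos)] with δ hδ _
      linarith [hδ.2]
  filter_upwards [Filter.eventually_all.2 fun i => Filter.eventually_all.2 (h i)] with δ hδ i j hij
  exact ball_disjoint_ball (hδ i j hij)

/-- A proximal semigroup without global fixed point contains players of a game of ping-pong: move
a repelling and an attracting point to different places of the circle. -/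
lemma exists_pingPong (hG : IsProximal (G : Set CircleHomeo))
    (hfix : ¬ HasGlobalFixedPoint (G : Set CircleHomeo)) (k : ℕ) :
    ∃ D : PingPong k, ∀ j, ∃ h ∈ D.player j, h ∈ G := by
  obtain ⟨r, a, hra⟩ := hG.exists_repelling_attracting
  let α : Fin k → UnitAddCircle := fun j => (infinite_orbit hG hfix a).natEmbedding _ j
  let β : Fin k → UnitAddCircle := fun j => (infinite_inverse_orbit hG hfix r).natEmbedding _ j
  have hα : α.Injective := fun i j hij =>
    Fin.ext ((infinite_orbit hG hfix a).natEmbedding _ |>.injective (Subtype.ext hij))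
  have hβ : β.Injective := fun i j hij =>
    Fin.ext ((infinite_inverse_orbit hG hfix r).natEmbedding _ |>.injective (Subtype.ext hij))
  obtain ⟨δ, ⟨hδα, hδβ⟩, hδ⟩ := (((eventually_disjoint_balls hα).and
    (eventually_disjoint_balls hβ)).and self_mem_nhdsWithin).exists
  choose b b' hb using fun j => exists_frontier_ball_subset (β j) δ
  let D : PingPong k :=
    { R := fun j => ball (β j) δ
      A := fun j => ball (α j) δ
      b := b
      b' := b'
      isOpen_R := fun _ => isOpen_ball
      frontier_R := hb
      disjoint_R := hδβ
      isOpen_A := fun _ => isOpen_ball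
      isPreconnected_A := fun j => isPreconnected_ball _ _
      nonempty_A := fun j => ⟨α j, mem_ball_self hδ⟩
      disjoint_A := hδα }
  refine ⟨D, fun j => ?_⟩
  obtain ⟨u, hu, huα⟩ : ∃ g ∈ G, g a = α j := ((infinite_orbit hG hfix a).natEmbedding _ j).2
  obtain ⟨v, hv, hvβ⟩ : ∃ g ∈ G, g (β j) = r :=
    ((infinite_inverse_orbit hG hfix r).natEmbedding _ j).2
  have hV : v '' ball (β j) δ ∈ 𝓝 r :=
    hvβ ▸ v.isOpenMap.image_mem_nhds (ball_mem_nhds _ hδ)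
  have hW : u ⁻¹' ball (α j) δ ∈ 𝓝 a :=
    u.continuous.continuousAt.preimage_mem_nhds (huα ▸ ball_mem_nhds _ hδ)
  obtain ⟨g, hg, hmaps⟩ := hra _ hV _ hW
  refine ⟨u * g * v, fun z hz => hmaps ?_, G.mul_mem (G.mul_mem hu hg) hv⟩
  rintro ⟨y, hy, hyz⟩
  exact hz (v.injective hyz ▸ hy)

/-! ### Players turn up with positive probability, uniformly near the given law -/

lemma mul_le_mconv_real {ρ σ : Measure CircleHomeo} [IsProbabilityMeasure ρ]
    [IsProbabilityMeasure σ] {U V W : Set CircleHomeo} (hU : IsOpen U)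
    (hVW : ∀ g ∈ V, ∀ h ∈ W, g * h ∈ U) : ρ.real V * σ.real W ≤ (ρ ∗ₘ σ).real U := by
  rw [Measure.mconv, map_measureReal_apply measurable_mul hU.measurableSet, ← measureReal_prod_prod]
  exact measureReal_mono fun p hp => hVW p.1 hp.1 p.2 hp.2

lemma half_mul_le_lazy_real {ρ : Measure CircleHomeo} [IsProbabilityMeasure ρ]
    (U : Set CircleHomeo) : ρ.real U / 2 ≤ (lazy ρ).real U := by
  have h : (2⁻¹ : ENNReal) * ρ U ≤ lazy ρ U := by simp [lazy]
  have h2 := ENNReal.toReal_mono (measure_ne_top _ _) h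
  rw [ENNReal.toReal_mul] at h2
  simp only [Measure.real]
  refine le_trans (le_of_eq ?_) h2
  simp
  ring

lemma half_le_lazy_real {ρ : Measure CircleHomeo} [IsProbabilityMeasure ρ]
    {U : Set CircleHomeo} (hU : (1 : CircleHomeo) ∈ U) : 1 / 2 ≤ (lazy ρ).real U := by
  have h : (2⁻¹ : ENNReal) ≤ lazy ρ U := by simp [lazy, hU]
  have h2 := ENNReal.toReal_mono (measure_ne_top _ _) h
  simpa [Measure.real] using h2

lemma pow_le_convPow_lazy_real {ρ : Measure CircleHomeo} [IsProbabilityMeasure ρ] (n : ℕ)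
    {U : Set CircleHomeo} (hU : IsOpen U) (h1 : (1 : CircleHomeo) ∈ U) :
    (1 / 2) ^ n ≤ (convPow (lazy ρ) n).real U := by
  induction n generalizing U with
  | zero => simp [convPow, Measure.real, h1]
  | succ n ih =>
    obtain ⟨V, hVo, hV1, hVU⟩ := exists_open_nhds_one_mul_subset (hU.mem_nhds h1)
    rw [pow_succ]
    calc ((1 : ℝ) / 2) ^ n * (1 / 2) ≤ (convPow (lazy ρ) n).real V * (lazy ρ).real V :=
          mul_le_mul (ih hVo hV1) (half_le_lazy_real hV1) (by norm_num) measureReal_nonneg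
      _ ≤ _ := mul_le_mconv_real hU fun g hg h hh => hVU (Set.mul_mem_mul hg hh)

lemma exists_eventually_le_real {μ : ProbabilityMeasure CircleHomeo} {s : CircleHomeo}
    (hs : s ∈ (μ : Measure CircleHomeo).support) {U : Set CircleHomeo} (hU : IsOpen U)
    (hsU : s ∈ U) : ∃ p : ℝ, 0 < p ∧ ∀ᶠ μ' : ProbabilityMeasure CircleHomeo in 𝓝 μ,
      p ≤ (μ' : Measure CircleHomeo).real U := by
  have hpos : 0 < (μ : Measure CircleHomeo) U :=
    (Measure.mem_support_iff_forall s).1 hs U (hU.mem_nhds hsU)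
  have hfin : (μ : Measure CircleHomeo) U ≠ ⊤ := measure_ne_top _ _
  have hlim : (μ : Measure CircleHomeo) U / 2 <
      liminf (fun μ' : ProbabilityMeasure CircleHomeo => (μ' : Measure CircleHomeo) U) (𝓝 μ) :=
    (ENNReal.half_lt_self hpos.ne' hfin).trans_le
      (ProbabilityMeasure.le_liminf_measure_open_of_tendsto tendsto_id hU)
  refine ⟨((μ : Measure CircleHomeo) U / 2).toReal, ENNReal.toReal_pos
    (ENNReal.half_pos hpos.ne').ne' (ENNReal.div_lt_top hfin two_ne_zero).ne, ?_⟩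
  filter_upwards [eventually_lt_of_lt_liminf hlim] with μ' h
  exact ENNReal.toReal_mono (measure_ne_top _ _) h.le

/-- Every neighbourhood of an element of the semigroup is hit by the lazy walk at all large times,
because the walk can wait. -/
lemma exists_eventually_le_convPow_lazy {μ : ProbabilityMeasure CircleHomeo} {h : CircleHomeo}
    (hh : h ∈ supportSemigroup μ) : ∀ U : Set CircleHomeo, IsOpen U → h ∈ U →
      ∃ k : ℕ, ∀ n ≥ k, ∃ p : ℝ, 0 < p ∧ ∀ᶠ μ' : ProbabilityMeasure CircleHomeo in 𝓝 μ,
        p ≤ (convPow (lazy (μ' : Measure CircleHomeo)) n).real U := by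
  have hsplit : ∀ (x y : CircleHomeo) (U : Set CircleHomeo), IsOpen U → x * y ∈ U →
      ∃ V W : Set CircleHomeo, IsOpen V ∧ IsOpen W ∧ x ∈ V ∧ y ∈ W ∧
        ∀ g ∈ V, ∀ h ∈ W, g * h ∈ U := by
    intro x y U hU hxy
    obtain ⟨V, W, hV, hW, hx, hy, hVW⟩ :=
      isOpen_prod_iff.1 (hU.preimage (continuous_mul (M := CircleHomeo))) x y hxy
    exact ⟨V, W, hV, hW, hx, hy, fun g hg h hh => hVW (Set.mk_mem_prod hg hh)⟩
  induction hh using Subsemigroup.closure_induction with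
  | mem s hs =>
    intro U hU hsU
    refine ⟨1, fun n hn => ?_⟩
    obtain ⟨m, rfl⟩ := Nat.exists_eq_add_of_le' hn
    obtain ⟨V, W, hV, hW, h1V, hsW, hVW⟩ := hsplit 1 s U hU (by rwa [one_mul])
    obtain ⟨p, hp, hev⟩ := exists_eventually_le_real hs hW hsW
    refine ⟨(1 / 2) ^ m * (p / 2), by positivity, ?_⟩
    filter_upwards [hev] with μ' hμ'
    calc (1 / 2) ^ m * (p / 2)
        ≤ (convPow (lazy (μ' : Measure CircleHomeo)) m).real V * (lazy (μ' : Measure _)).real W :=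
          mul_le_mul (pow_le_convPow_lazy_real m hV h1V)
            (le_trans (by linarith) (half_mul_le_lazy_real W)) (by positivity) measureReal_nonneg
      _ ≤ _ := mul_le_mconv_real hU hVW
  | mul x y _ _ hx hy =>
    intro U hU hxyU
    obtain ⟨V, W, hV, hW, hxV, hyW, hVW⟩ := hsplit x y U hU hxyU
    obtain ⟨k, hk⟩ := hx V hV hxV
    obtain ⟨l, hl⟩ := hy W hW hyW
    refine ⟨k + l, fun n hn => ?_⟩
    obtain ⟨m, rfl⟩ := Nat.exists_eq_add_of_le' (le_trans (Nat.le_add_left l k) hn)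
    obtain ⟨p, hp, hevp⟩ := hk m (by omega)
    obtain ⟨q, hq, hevq⟩ := hl l le_rfl
    refine ⟨p * q, by positivity, ?_⟩
    filter_upwards [hevp, hevq] with μ' h1 h2
    rw [convPow_add]
    exact (mul_le_mul h1 h2 hq.le measureReal_nonneg).trans (mul_le_mconv_real hU hVW)

lemma exists_eventually_le_player {μ : ProbabilityMeasure CircleHomeo} {k : ℕ} (D : PingPong k)
    (hD : ∀ j, ∃ h ∈ D.player j, h ∈ supportSemigroup μ) :
    ∃ N : ℕ, 0 < N ∧ ∃ p : ℝ, 0 < p ∧ ∀ᶠ μ' : ProbabilityMeasure CircleHomeo in 𝓝 μ,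
      ∀ j, p ≤ (convPow (lazy (μ' : Measure CircleHomeo)) N).real (D.player j) := by
  have h1 : ∀ j, ∃ k : ℕ, ∀ n ≥ k, ∃ p : ℝ, 0 < p ∧
      ∀ᶠ μ' : ProbabilityMeasure CircleHomeo in 𝓝 μ,
        p ≤ (convPow (lazy (μ' : Measure CircleHomeo)) n).real (D.player j) := by
    intro j
    obtain ⟨h, hh, hG⟩ := hD j
    exact exists_eventually_le_convPow_lazy hG _ (D.isOpen_player j) hh
  choose m hm using h1
  set N := Finset.univ.sup m + 1 with hN
  choose p hp hev using fun j =>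
    hm j N ((Finset.le_sup (Finset.mem_univ j)).trans (Nat.le_succ _))
  obtain ⟨q, hq, hqp⟩ : ∃ q : ℝ, 0 < q ∧ ∀ j, q ≤ p j := by
    have : ∀ᶠ q : ℝ in 𝓝[>] 0, ∀ j, q ≤ p j :=
      Filter.eventually_all.2 fun j => by
        filter_upwards [Ioo_mem_nhdsGT (hp j)] with q hq
        exact hq.2.le
    obtain ⟨q, hq, hq0⟩ := (this.and self_mem_nhdsWithin).exists
    exact ⟨q, hq0, hq⟩
  refine ⟨N, Nat.succ_pos _, q, hq, ?_⟩
  filter_upwards [Filter.eventually_all.2 hev] with μ' h j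
  exact (hqp j).trans (h j)

/-! ### Decay of the mean distance -/

lemma EnergyLE.iterate_avg {F : UnitAddCircle → UnitAddCircle → ℝ} (hK : IsKernel F)
    {ρ : Measure CircleHomeo} [IsProbabilityMeasure ρ] {c : ℝ} (hF : EnergyLE F c) (n : ℕ) :
    EnergyLE ((CircleHomeo.avg ρ)^[n] F) c := by
  induction n with
  | zero => exact hF
  | succ n ih =>
    rw [Function.iterate_succ_apply']
    exact ih.avg (hK.iterate_avg n)

lemma energyLE_iterate_mul {ρ : Measure CircleHomeo} [IsProbabilityMeasure ρ] (D : PingPong 40)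
    {N : ℕ} {p : ℝ} (hp : ∀ j, p ≤ (convPow ρ N).real (D.player j)) (m : ℕ) :
    EnergyLE ((avg ρ)^[N * m] fun x y => dist x y) (((1 - p / 2) ^ m) ^ 2) := by
  induction m with
  | zero => simpa using energyLE_dist
  | succ m ih =>
    have hK : IsKernel ((avg ρ)^[N * m] fun x y => dist x y) := isKernel_dist.iterate_avg _
    have h := ih.avg_of_pingPong hK D hp
    rw [avg_convPow hK, ← Function.iterate_add_apply] at h
    have h1 : N + N * m = N * (m + 1) := by ring
    have h2 : (1 - p / 2) ^ 2 * ((1 - p / 2) ^ m) ^ 2 = ((1 - p / 2) ^ (m + 1)) ^ 2 := by ring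
    rwa [h1, h2] at h

lemma iterate_avg_dist_le {ρ : Measure CircleHomeo} [IsProbabilityMeasure ρ] (D : PingPong 40)
    {N : ℕ} {p : ℝ} (hp : ∀ j, p ≤ (convPow (lazy ρ) N).real (D.player j))
    {n : ℕ} (hn : 0 < n) (x y : UnitAddCircle) :
    (avg ρ)^[n] (fun x y => dist x y) x y ≤ 2 * n * (1 - p / 2) ^ (2 * n / N) := by
  have hp1 : p ≤ 1 := (hp 0).trans measureReal_le_one
  refine (iterate_avg_le_lazy isKernel_dist hn x y).trans
    (mul_le_mul_of_nonneg_left ?_ (by positivity))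
  have h := (energyLE_iterate_mul D hp (2 * n / N)).iterate_avg
    (isKernel_dist.iterate_avg _) (2 * n % N) (ρ := lazy ρ)
  rw [← Function.iterate_add_apply, Nat.mod_add_div] at h
  exact le_of_sq_le_sq (h.sq_le x y) (pow_nonneg (by linarith) _)

/-- The rate of synchronization that results from the contraction factor `q` in every `N` steps. -/
lemma exists_rate {q : ℝ} (hq0 : 0 < q) (hq1 : q < 1) {N : ℕ} (hN : 0 < N) :
    ∃ κ : ℝ, 0 < κ ∧ ∀ n : ℕ,
      2 * n * q ^ (2 * n / N) ≤ 1 / κ * Real.exp (-κ * n) * Real.exp (-κ * n) := by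
  have hN' : (0 : ℝ) < N := by exact_mod_cast hN
  set β := -Real.log q / N with hβ
  have hβ0 : 0 < β := div_pos (neg_pos.2 (Real.log_neg hq0 hq1)) hN'
  have hqβ : q = Real.exp (-(β * N)) := by
    rw [hβ, div_mul_cancel₀ _ hN'.ne', neg_neg, Real.exp_log hq0]
  set κ := β * q / 2 with hκ
  have hκ0 : 0 < κ := by positivity
  refine ⟨κ, hκ0, fun n => ?_⟩
  have h1 : q * q ^ (2 * n / N) ≤ Real.exp (-(2 * β * n)) := by
    rw [← pow_succ', hqβ, ← Real.exp_nat_mul, Real.exp_le_exp]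
    have h2 : 2 * n ≤ N * (2 * n / N + 1) := by
      rw [mul_add, mul_one]
      have := Nat.div_add_mod (2 * n) N
      have := Nat.mod_lt (2 * n) hN
      omega
    have h3 : (2 * n : ℝ) ≤ N * ((2 * n / N + 1 : ℕ) : ℝ) := by exact_mod_cast h2
    nlinarith
  have h4 : β * n ≤ Real.exp (β * n) := by linarith [Real.add_one_le_exp (β * n)]
  have h5 : κ * (2 * n * q ^ (2 * n / N)) ≤ Real.exp (-(β * n)) :=
    calc κ * (2 * n * q ^ (2 * n / N)) = β * n * (q * q ^ (2 * n / N)) := by rw [hκ]; ring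
      _ ≤ Real.exp (β * n) * Real.exp (-(2 * β * n)) := by gcongr
      _ = Real.exp (-(β * n)) := by rw [← Real.exp_add]; ring_nf
  have h6 : Real.exp (-(β * n)) ≤ Real.exp (-κ * n) * Real.exp (-κ * n) := by
    rw [← Real.exp_add, Real.exp_le_exp]
    have : κ + κ ≤ β := by rw [hκ]; nlinarith
    have hn : (0 : ℝ) ≤ n := n.cast_nonneg
    nlinarith
  rw [mul_assoc (1 / κ), one_div, inv_mul_eq_div, le_div_iff₀ hκ0]
  linarith

/-! ### The random walks -/

section Walk

variable {Ω : Type*} {g : ℕ → Ω → CircleHomeo}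

/-- The σ-algebra generated by the first `n` steps. -/
abbrev pastSteps (g : ℕ → Ω → CircleHomeo) (n : ℕ) : MeasurableSpace Ω :=
  ⨆ i ∈ Set.Iio n, MeasurableSpace.comap (g i) inferInstance

lemma pastSteps_mono {m n : ℕ} (h : m ≤ n) : pastSteps g m ≤ pastSteps g n :=
  biSup_mono fun _ hi => lt_of_lt_of_le hi h

lemma measurable_step (n : ℕ) : Measurable[pastSteps g (n + 1)] (g n) :=
  measurable_iff_comap_le.2
    (le_biSup (fun i => MeasurableSpace.comap (g i) inferInstance) (Nat.lt_succ_self n))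

lemma measurable_leftWalk (n : ℕ) : Measurable[pastSteps g n] (leftWalk g n) := by
  induction n with
  | zero => exact measurable_const
  | succ n ih => exact (measurable_step n).mul (ih.mono (pastSteps_mono n.le_succ) le_rfl)

lemma measurable_rightWalk (n : ℕ) : Measurable[pastSteps g n] (rightWalk g n) := by
  induction n with
  | zero => exact measurable_const
  | succ n ih => exact (ih.mono (pastSteps_mono n.le_succ) le_rfl).mul (measurable_step n)

variable [MeasurableSpace Ω] {P : Measure Ω} {μ : ProbabilityMeasure CircleHomeo}

lemma IsIIDSteps.pastSteps_le (hg : IsIIDSteps P μ g) (n : ℕ) :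
    pastSteps g n ≤ ‹MeasurableSpace Ω› :=
  iSup₂_le fun i _ => (hg.measurable i).comap_le

lemma IsIIDSteps.indepFun (hg : IsIIDSteps P μ g) {n : ℕ} {Z : Ω → CircleHomeo}
    (hZ : Measurable[pastSteps g n] Z) : IndepFun Z (g n) P := by
  have h := indep_iSup_of_disjoint (fun i => (hg.measurable i).comap_le) hg.indep.iIndep
    (S := Set.Iio n) (T := {n}) (by simp)
  rw [IndepFun_iff_Indep]
  refine indep_of_indep_of_le_left (indep_of_indep_of_le_right h ?_) hZ.comap_le
  exact le_biSup (fun i => MeasurableSpace.comap (g i) inferInstance) (Set.mem_singleton n)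

variable [IsProbabilityMeasure P]

lemma IsIIDSteps.map_rightWalk (hg : IsIIDSteps P μ g) (n : ℕ) :
    P.map (rightWalk g n) = convPow (μ : Measure CircleHomeo) n := by
  induction n with
  | zero => simp [rightWalk, convPow, Measure.map_const]
  | succ n ih =>
    have hm := (measurable_rightWalk (g := g) n).mono (hg.pastSteps_le n) le_rfl
    change P.map (rightWalk g n * g n) = _
    rw [(hg.indepFun (measurable_rightWalk n)).map_mul_eq_map_mconv_map hm (hg.measurable n), ih,
      hg.law n]
    rfl

lemma IsIIDSteps.map_leftWalk (hg : IsIIDSteps P μ g) (n : ℕ) :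
    P.map (leftWalk g n) = convPow (μ : Measure CircleHomeo) n := by
  induction n with
  | zero => simp [leftWalk, convPow, Measure.map_const]
  | succ n ih =>
    have hm := (measurable_leftWalk (g := g) n).mono (hg.pastSteps_le n) le_rfl
    change P.map (g n * leftWalk g n) = _
    rw [(hg.indepFun (measurable_leftWalk n)).symm.map_mul_eq_map_mconv_map (hg.measurable n) hm,
      ih, hg.law n, add_comm, convPow_add, convPow_one]

lemma synchronizesWith_of_iterate_avg_le {κ : ℝ} {Z : ℕ → Ω → CircleHomeo}
    (hZ : ∀ n, Measurable (Z n))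
    (hlaw : ∀ n, P.map (Z n) = convPow (μ : Measure CircleHomeo) n)
    (h : ∀ n : ℕ, 0 < n → ∀ x y, (avg (μ : Measure CircleHomeo))^[n] (fun x y => dist x y) x y ≤
      1 / κ * Real.exp (-κ * n) * Real.exp (-κ * n)) :
    SynchronizesWith P Z κ := by
  intro x y n hn
  have hm : Measurable fun ω => dist (Z n ω x) (Z n ω y) :=
    (isKernel_dist.measurable_comp x y).comp (hZ n)
  have hint : ∫ ω, dist (Z n ω x) (Z n ω y) ∂P =
      (avg (μ : Measure CircleHomeo))^[n] (fun x y => dist x y) x y := by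
    rw [← avg_convPow isKernel_dist, ← hlaw n]
    exact (integral_map (hZ n).aemeasurable
      (isKernel_dist.measurable_comp x y).aestronglyMeasurable).symm
  have hi : Integrable (fun ω => dist (Z n ω x) (Z n ω y)) P := by
    refine Integrable.of_bound hm.aestronglyMeasurable 1 (ae_of_all _ fun ω => ?_)
    rw [Real.norm_eq_abs, abs_of_nonneg dist_nonneg]
    exact isKernel_dist.le_one _ _
  have hmarkov := mul_meas_ge_le_integral_of_nonneg (ae_of_all P fun ω => dist_nonneg) hi
    (Real.exp (-κ * n))
  rw [hint] at hmarkov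
  have hbad : P.real {ω | Real.exp (-κ * n) ≤ dist (Z n ω x) (Z n ω y)} ≤
      1 / κ * Real.exp (-κ * n) := by
    refine le_of_mul_le_mul_left ?_ (Real.exp_pos (-κ * n))
    rw [mul_comm _ (1 / κ * _)]
    exact hmarkov.trans (h n hn x y)
  have hcompl : {ω | dist (Z n ω x) (Z n ω y) < Real.exp (-κ * n)} =
      {ω | Real.exp (-κ * n) ≤ dist (Z n ω x) (Z n ω y)}ᶜ := by
    ext ω
    simp
  rw [hcompl, probReal_compl_eq_one_sub (measurableSet_le measurable_const hm)]
  linarith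

end Walk

end CircleHomeo

theorem theorem1p5 (μ : ProbabilityMeasure CircleHomeo)
    (hprox : CircleHomeo.IsProximal (CircleHomeo.supportSemigroup μ : Set CircleHomeo))
    (hfix : ¬ CircleHomeo.HasGlobalFixedPoint
      (CircleHomeo.supportSemigroup μ : Set CircleHomeo)) :
    ∃ κ : ℝ, 0 < κ ∧ ∃ U : Set (ProbabilityMeasure CircleHomeo), IsOpen U ∧ μ ∈ U ∧
      ∀ μ' ∈ U, ∀ (Ω : Type*) [MeasurableSpace Ω] (P : Measure Ω) [IsProbabilityMeasure P]
        (g : ℕ → Ω → CircleHomeo), CircleHomeo.IsIIDSteps P μ' g →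
          CircleHomeo.SynchronizesWith P (CircleHomeo.leftWalk g) κ ∧
          CircleHomeo.SynchronizesWith P (CircleHomeo.rightWalk g) κ := by
  obtain ⟨D, hD⟩ := CircleHomeo.exists_pingPong hprox hfix 40
  obtain ⟨N, hN, p, hp, hev⟩ := CircleHomeo.exists_eventually_le_player D hD
  have hp1 : p ≤ 1 := (hev.self_of_nhds 0).trans measureReal_le_one
  obtain ⟨κ, hκ, hrate⟩ := CircleHomeo.exists_rate (q := 1 - p / 2) (by linarith) (by linarith) hN
  obtain ⟨U, hU, hUo, hμU⟩ := eventually_nhds_iff.1 hev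
  refine ⟨κ, hκ, U, hUo, hμU, fun μ' hμ' Ω _ P _ g hg => ?_⟩
  have hdecay : ∀ n : ℕ, 0 < n → ∀ x y,
      (CircleHomeo.avg (μ' : Measure CircleHomeo))^[n] (fun x y => dist x y) x y ≤
        1 / κ * Real.exp (-κ * n) * Real.exp (-κ * n) := fun n hn x y =>
    (CircleHomeo.iterate_avg_dist_le D (hU μ' hμ') hn x y).trans (hrate n)
  constructor
  · exact CircleHomeo.synchronizesWith_of_iterate_avg_le
      (fun n => (CircleHomeo.measurable_leftWalk n).mono (hg.pastSteps_le n) le_rfl)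
      hg.map_leftWalk hdecay
  · exact CircleHomeo.synchronizesWith_of_iterate_avg_le
      (fun n => (CircleHomeo.measurable_rightWalk n).mono (hg.pastSteps_le n) le_rfl)
      hg.map_rightWalk hdecay
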